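/- Let $\zeta$ be the Riemann zeta function and $\gamma$ Euler's constant. Let $\omega\in\mathbb{C}$ with $\operatorname{Re}\omega>-\tfrac12$. Then the series $$\nu_\omega=\sum_{j=2}^{\infty}(-1)^j\frac{\zeta(j)}{j+\omega}$$ converges (as the limit of its partial sums) and, for each of the two choices of the sign $\pm$ (the same sign in both places), $$\nu_\omega=-\frac{1}{(\omega+1)^2}+\frac{\gamma}{\omega+1}-\frac12\int_{-\infty}^{\infty}\frac{\zeta\left(\tfrac12\pm ix\right)}{\left(\tfrac12\pm ix+\omega\right)\cosh \pi x}\,dx .$$ The integral is absolutely convergent, and its kernel decreases exponentially: there is a constant $C$, depending only on $\omega$ and the sign, such that $$\left|\frac{1}{\left(\tfrac12\pm ix+\omega\right)\cosh\pi x}\right|\le C e^{-\pi|x|}\qquad\text{for all } x\in\mathbb{R}.$$ -/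

import Mathlib

open Filter Topology MeasureTheory

/-- The `N`-th partial sum `∑_{j=2}^{N} (-1)^j ζ(j) / (j + ω)` of the series `ν_ω`. -/
noncomputable def nuPartialSum (ω : ℂ) (N : ℕ) : ℂ :=
  ∑ j ∈ Finset.Icc 2 N, (-1 : ℂ) ^ j * riemannZeta (j : ℂ) / ((j : ℂ) + ω)

/-- The kernel `1 / ((1/2 + ε i x + ω) cosh (π x))`, where `ε = ±1`. -/
noncomputable def nuKernel (ω : ℂ) (ε : ℝ) (x : ℝ) : ℂ :=
  1 / ((1 / 2 + (ε : ℂ) * Complex.I * (x : ℂ) + ω) * (Real.cosh (Real.pi * x) : ℂ))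

/-!
The weight `1 / cosh (π y)` is, up to sign, the restriction of `1 / sin (π s)` to every vertical
line `Re s = m + 1/2` with `m` an integer. Write
`J g c = ∫ y, g (c + i y) / cosh (π y)` (`sechIntegral`). If `g` is holomorphic near the strip
`|Re s - m| ≤ 1/2` and grows there at most like `exp (π |Im s| / 2)`, then
`J g (m + 1/2) + J g (m - 1/2) = 2 g(m)`
(`sechIntegral_add_half_add_sechIntegral_sub_half`): after translation to `m = 0`, the function
`(g s - g 0) / sin (π s)` has no singularity in the strip, so Cauchy's theorem equates its integrals
over the two boundary lines, and `∫ 1 / cosh (π y) = 1` accounts for the constant `g 0`. No residue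
calculus is needed.

Take `G s = ζ(s) / (s + ω)`. For `m = j ≥ 2` this identity makes the alternating sum telescope:
`2 ∑_{j=2}^N (-1)^j G(j) = (-1)^N J G (N + 1/2) + J G (3/2)` (`two_mul_nuPartialSum`), and
`J G (N + 1/2) → 0` because `ζ` is bounded on `Re s ≥ 3/2`. Around `s = 1` one has
`G s = (1 + ω)⁻¹ / (s - 1) + g s` with `g s = (ζ₀(s) - (1 + ω)⁻¹) / (s + ω)`, where
`ζ₀(s) = ζ(s) - 1 / (s - 1)` is entire and `ζ₀(1) = γ`. The polar part is odd about `s = 1` and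
contributes nothing to `J G (3/2) + J G (1/2)`, which is therefore
`2 g(1) = 2 (γ / (ω + 1) - 1 / (ω + 1) ^ 2)`
(`sechIntegral_zeta_div_add_three_halves_add_half`).

The growth condition on `1/2 ≤ Re s ≤ 3/2` (`exists_norm_riemannZeta_le_exp`) comes from
`ζ = Λ / Γ_ℝ`: the entire part of `Λ` is a Mellin transform, hence bounded on vertical strips, and
Euler's reflection formula bounds `1 / Γ(s/2)` by a multiple of `exp (π |Im s| / 2)`.
-/

/-! ### Growth of the zeta function in vertical strips -/

/-- A Mellin transform is bounded on a closed vertical strip when it converges absolutely on both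
edges, since `t ^ (σ - 1) ≤ t ^ (a - 1) + t ^ (b - 1)` for `a ≤ σ ≤ b`. -/
lemma exists_norm_mellin_le {f : ℝ → ℂ} {a b : ℝ} (ha : MellinConvergent f a)
    (hb : MellinConvergent f b) :
    ∃ C : ℝ, ∀ s : ℂ, a ≤ s.re → s.re ≤ b → ‖mellin f s‖ ≤ C := by
  refine ⟨∫ t in Set.Ioi (0 : ℝ), (‖(t : ℂ) ^ ((a : ℂ) - 1) • f t‖ +
    ‖(t : ℂ) ^ ((b : ℂ) - 1) • f t‖), fun s has hsb ↦ ?_⟩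
  refine norm_integral_le_of_norm_le (ha.norm.add hb.norm) ?_
  filter_upwards [ae_restrict_mem measurableSet_Ioi] with t (ht : 0 < t)
  simp only [norm_smul, Complex.norm_cpow_eq_rpow_re_of_pos ht, Complex.sub_re, Complex.one_re,
    Complex.ofReal_re]
  rw [← add_mul]
  gcongr
  rcases le_total 1 t with h | h
  · exact (Real.rpow_le_rpow_of_exponent_le h (by linarith)).trans
      (le_add_of_nonneg_left (by positivity))
  · exact (Real.rpow_le_rpow_of_exponent_ge ht h (by linarith)).trans
      (le_add_of_nonneg_right (by positivity))

lemma Complex.norm_sin_le_exp_abs_im (z : ℂ) : ‖Complex.sin z‖ ≤ Real.exp |z.im| := by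
  have h1 : ‖Complex.exp (-z * I)‖ ≤ Real.exp |z.im| := by
    rw [Complex.norm_exp]; gcongr; simpa using le_abs_self z.im
  have h2 : ‖Complex.exp (z * I)‖ ≤ Real.exp |z.im| := by
    rw [Complex.norm_exp]; gcongr; simpa using neg_le_abs z.im
  rw [Complex.sin, norm_div, norm_mul, Complex.norm_I, mul_one, Complex.norm_two]
  linarith [norm_sub_le (Complex.exp (-z * I)) (Complex.exp (z * I))]

lemma Complex.sinh_abs_im_le_norm_sin (z : ℂ) : Real.sinh |z.im| ≤ ‖Complex.sin z‖ := by
  have h1 : ‖Complex.exp (-z * I)‖ = Real.exp z.im := by rw [Complex.norm_exp]; simp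
  have h2 : ‖Complex.exp (z * I)‖ = Real.exp (-z.im) := by rw [Complex.norm_exp]; simp
  have h3 := abs_norm_sub_norm_le (Complex.exp (-z * I)) (Complex.exp (z * I))
  rw [Complex.sin, norm_div, norm_mul, Complex.norm_I, mul_one, Complex.norm_two]
  rw [h1, h2] at h3
  rw [Real.sinh_eq]
  have : Real.exp |z.im| - Real.exp (-|z.im|) ≤ |Real.exp z.im - Real.exp (-z.im)| := by
    rcases abs_cases z.im with ⟨h, -⟩ | ⟨h, -⟩ <;> rw [h]
    · exact le_abs_self _
    · rw [neg_neg]; exact (le_abs_self _).trans_eq (abs_sub_comm _ _)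
  linarith

lemma exists_norm_completedRiemannZeta₀_le (a b : ℝ) :
    ∃ C : ℝ, ∀ s : ℂ, a ≤ s.re → s.re ≤ b → ‖completedRiemannZeta₀ s‖ ≤ C := by
  have hconv (s : ℂ) : MellinConvergent (HurwitzZeta.hurwitzEvenFEPair 0).f_modif s :=
    ((HurwitzZeta.hurwitzEvenFEPair 0).isStrongFEPair_toStrongFEPair.hasMellin s).1
  obtain ⟨C, hC⟩ := exists_norm_mellin_le (hconv ((a / 2 : ℝ) : ℂ)) (hconv ((b / 2 : ℝ) : ℂ))
  refine ⟨C / 2, fun s ha hb ↦ ?_⟩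
  have hs : (s / 2).re = s.re / 2 := by simp
  have := hC (s / 2) (by rw [hs]; linarith) (by rw [hs]; linarith)
  change ‖mellin (HurwitzZeta.hurwitzEvenFEPair 0).f_modif (s / 2) / 2‖ ≤ C / 2
  rw [norm_div, Complex.norm_two]
  gcongr

lemma Complex.exists_norm_Gamma_le {a b : ℝ} (ha : 0 < a) (hab : a ≤ b) :
    ∃ C : ℝ, ∀ s : ℂ, a ≤ s.re → s.re ≤ b → ‖Complex.Gamma s‖ ≤ C := by
  have hconv (x : ℝ) (hx : 0 < x) :
      MellinConvergent (fun t : ℝ ↦ ((Real.exp (-t) : ℝ) : ℂ)) (x : ℂ) := by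
    refine (Complex.GammaIntegral_convergent (s := x) (by simpa using hx)).congr ?_
    filter_upwards with t
    simp [mul_comm]
  obtain ⟨C, hC⟩ := exists_norm_mellin_le (hconv a ha) (hconv b (ha.trans_le hab))
  refine ⟨C, fun s has hsb ↦ ?_⟩
  rw [Complex.Gamma_eq_integral (ha.trans_le has), Complex.GammaIntegral_eq_mellin]
  exact hC s has hsb

/-- A crude growth bound for `ζ` around the pole's abscissa. The region `|Im s| < 1` is excluded
only to stay away from the pole; the exponent `π / 2` is far from optimal, but it is beaten by the
decay `exp (-π |y|)` of `1 / cosh (π y)`. -/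
lemma exists_norm_riemannZeta_le_exp :
    ∃ B : ℝ, ∀ s : ℂ, 1 / 2 ≤ s.re → s.re ≤ 3 / 2 → 1 ≤ |s.im| →
      ‖riemannZeta s‖ ≤ B * Real.exp (Real.pi / 2 * |s.im|) := by
  obtain ⟨C₁, h₁⟩ := exists_norm_completedRiemannZeta₀_le (1 / 2) (3 / 2)
  obtain ⟨C₂, h₂⟩ := Complex.exists_norm_Gamma_le (a := 1 / 4) (b := 3 / 4) (by norm_num)
    (by norm_num)
  refine ⟨(C₁ + 2) * (C₂ * Real.pi), fun s hl hr ht ↦ ?_⟩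
  have hs : s ≠ 0 := by rintro rfl; norm_num at hl
  have hn : 1 ≤ ‖s‖ := ht.trans (Complex.abs_im_le_norm s)
  have hn' : 1 ≤ ‖1 - s‖ := ht.trans (by simpa using Complex.abs_im_le_norm (1 - s))
  have hpi : (Real.pi : ℂ) ≠ 0 := by exact_mod_cast Real.pi_ne_zero
  have hnum : ‖completedRiemannZeta₀ s - 1 / s - 1 / (1 - s)‖ ≤ C₁ + 2 := by
    have e1 : ‖1 / s‖ ≤ 1 := by
      rw [norm_div, norm_one]; exact div_le_one_of_le₀ hn (norm_nonneg _)
    have e2 : ‖1 / (1 - s)‖ ≤ 1 := by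
      rw [norm_div, norm_one]; exact div_le_one_of_le₀ hn' (norm_nonneg _)
    have := norm_sub_le (completedRiemannZeta₀ s - 1 / s) (1 / (1 - s))
    have := norm_sub_le (completedRiemannZeta₀ s) (1 / s)
    linarith [h₁ s hl hr]
  have hre : (1 - s / 2).re = 1 - s.re / 2 := by simp
  have hG : ‖Complex.Gamma (1 - s / 2)‖ ≤ C₂ :=
    h₂ _ (by rw [hre]; linarith) (by rw [hre]; linarith)
  have hsin : ‖Complex.sin (Real.pi * (s / 2))‖ ≤ Real.exp (Real.pi / 2 * |s.im|) := by
    refine (Complex.norm_sin_le_exp_abs_im _).trans_eq ?_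
    have : ((Real.pi : ℂ) * (s / 2)).im = Real.pi / 2 * s.im := by
      simp; ring
    rw [this, abs_mul, abs_of_pos (by positivity)]
  have hsin0 : Complex.sin (Real.pi * (s / 2)) ≠ 0 := by
    rw [← norm_pos_iff]
    refine lt_of_lt_of_le (Real.sinh_pos_iff.2 ?_) (Complex.sinh_abs_im_le_norm_sin _)
    have : ((Real.pi : ℂ) * (s / 2)).im = Real.pi / 2 * s.im := by
      simp; ring
    rw [this, abs_mul]
    have := Real.pi_pos
    positivity
  -- Euler's reflection formula turns the reciprocal of `Γ (s / 2)` into `Γ (1 - s / 2)`.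
  have hrec : (((Real.pi : ℂ) ^ (-s / 2) * Complex.Gamma (s / 2)))⁻¹ =
      (Real.pi : ℂ) ^ (s / 2 - 1) * (Complex.Gamma (1 - s / 2) *
        Complex.sin (Real.pi * (s / 2))) := by
    have key := Complex.Gamma_mul_Gamma_one_sub (s / 2)
    rw [eq_div_iff hsin0] at key
    have hp : (Real.pi : ℂ) ^ (-s / 2) * (Real.pi : ℂ) ^ (s / 2 - 1) * Real.pi = 1 := by
      rw [← Complex.cpow_add _ _ hpi]
      nth_rw 2 [← Complex.cpow_one (Real.pi : ℂ)]
      rw [← Complex.cpow_add _ _ hpi]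
      ring_nf
      simp
    refine inv_eq_of_mul_eq_one_right ?_
    linear_combination (Real.pi : ℂ) ^ (-s / 2) * (Real.pi : ℂ) ^ (s / 2 - 1) * key + hp
  have hpow : ‖(Real.pi : ℂ) ^ (s / 2 - 1)‖ ≤ Real.pi := by
    rw [Complex.norm_cpow_eq_rpow_re_of_pos Real.pi_pos]
    have : (s / 2 - 1).re = s.re / 2 - 1 := by simp
    rw [this]
    exact (Real.rpow_le_rpow_of_exponent_le (by linarith [Real.pi_gt_three])
      (by linarith)).trans_eq (Real.rpow_one _)
  have hC₂ : 0 ≤ C₂ := (norm_nonneg _).trans hG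
  have hC₁ : 0 ≤ C₁ + 2 := (norm_nonneg _).trans hnum
  rw [riemannZeta_eq_completedRiemannZeta₀ hs, div_eq_mul_inv, hrec]
  simp only [norm_mul]
  calc _ ≤ (C₁ + 2) * (Real.pi * (C₂ * Real.exp (Real.pi / 2 * |s.im|))) := by gcongr
    _ = _ := by ring

lemma exists_norm_riemannZeta_le_of_three_halves_le_re :
    ∃ C : ℝ, ∀ s : ℂ, 3 / 2 ≤ s.re → ‖riemannZeta s‖ ≤ C := by
  have hsum : Summable fun n : ℕ ↦ 1 / ((n + 1 : ℕ) : ℝ) ^ (3 / 2 : ℝ) :=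
    (summable_nat_add_iff 1).2 (Real.summable_one_div_nat_rpow.2 (by norm_num))
  refine ⟨∑' n : ℕ, 1 / ((n + 1 : ℕ) : ℝ) ^ (3 / 2 : ℝ), fun s hs ↦ ?_⟩
  rw [zeta_eq_tsum_one_div_nat_add_one_cpow (by linarith)]
  refine tsum_of_norm_bounded hsum.hasSum fun n ↦ ?_
  have e : (n : ℂ) + 1 = (((n + 1 : ℕ) : ℝ) : ℂ) := by push_cast; ring
  rw [norm_div, norm_one, e, Complex.norm_cpow_eq_rpow_re_of_pos (by positivity)]
  gcongr
  simp

lemma exists_norm_riemannZeta₀_le_exp :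
    ∃ B : ℝ, ∀ s : ℂ, 1 / 2 ≤ s.re → s.re ≤ 3 / 2 →
      ‖riemannZeta₀ s‖ ≤ B * Real.exp (Real.pi / 2 * |s.im|) := by
  obtain ⟨B, hB⟩ := exists_norm_riemannZeta_le_exp
  obtain ⟨K, hK⟩ := ((isCompact_Icc (a := (1 / 2 : ℝ)) (b := 3 / 2)).reProdIm
    (isCompact_Icc (a := (-1 : ℝ)) (b := 1))).exists_bound_of_continuousOn
    differentiable_riemannZeta₀.continuous.continuousOn
  refine ⟨max (B + 1) K, fun s hl hr ↦ ?_⟩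
  have hexp : 1 ≤ Real.exp (Real.pi / 2 * |s.im|) :=
    Real.one_le_exp (by have := Real.pi_pos; positivity)
  rcases le_total 1 |s.im| with ht | ht
  · have hs : s ≠ 1 := by rintro rfl; norm_num at ht
    have h1 : 1 ≤ ‖s - 1‖ := ht.trans (by simpa using Complex.abs_im_le_norm (s - 1))
    have h2 : ‖(s - 1)⁻¹‖ ≤ 1 := by rw [norm_inv]; exact inv_le_one_of_one_le₀ h1
    have h3 : riemannZeta₀ s = riemannZeta s - (s - 1)⁻¹ := by simp [riemannZeta₀, hs]
    calc ‖riemannZeta₀ s‖ ≤ ‖riemannZeta s‖ + ‖(s - 1)⁻¹‖ := by rw [h3]; exact norm_sub_le _ _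
      _ ≤ B * Real.exp (Real.pi / 2 * |s.im|) + 1 * Real.exp (Real.pi / 2 * |s.im|) := by
          linarith [hB s hl hr ht]
      _ = (B + 1) * Real.exp (Real.pi / 2 * |s.im|) := by ring
      _ ≤ _ := by gcongr; exact le_max_left _ _
  · have h := hK s ⟨⟨hl, hr⟩, abs_le.1 ht⟩
    have hK0 : 0 ≤ K := (norm_nonneg _).trans h
    calc ‖riemannZeta₀ s‖ ≤ K * 1 := by rw [mul_one]; exact h
      _ ≤ _ := by
        gcongr
        exact le_max_right _ _

/-! ### The weight `1 / cosh (π y)` and its integrals over vertical lines -/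

lemma integrable_exp_neg_mul_abs {b : ℝ} (hb : 0 < b) :
    Integrable (fun x : ℝ ↦ Real.exp (-(b * |x|))) := by
  rw [← integrableOn_univ, ← Set.Iic_union_Ioi (a := (0 : ℝ))]
  refine ((integrableOn_exp_mul_Iic hb 0).congr_fun (fun x hx ↦ ?_) measurableSet_Iic).union
    ((exp_neg_integrableOn_Ioi 0 hb).congr_fun (fun x hx ↦ ?_) measurableSet_Ioi)
  · simp [abs_of_nonpos (Set.mem_Iic.1 hx)]
  · simp [abs_of_pos (Set.mem_Ioi.1 hx)]

lemma Real.exp_abs_div_two_le_cosh (x : ℝ) : Real.exp |x| / 2 ≤ Real.cosh x := by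
  rw [← Real.cosh_abs, Real.cosh_eq]
  linarith [Real.exp_pos (-|x|)]

lemma one_div_cosh_pi_mul_le (x : ℝ) :
    1 / Real.cosh (Real.pi * x) ≤ 2 * Real.exp (-(Real.pi * |x|)) := by
  have h := Real.exp_abs_div_two_le_cosh (Real.pi * x)
  rw [abs_mul, abs_of_pos Real.pi_pos] at h
  rw [Real.exp_neg, div_le_iff₀ (Real.cosh_pos _)]
  have := Real.exp_pos (Real.pi * |x|)
  field_simp
  linarith

lemma integral_one_div_cosh_pi_mul :
    Integrable (fun x : ℝ ↦ 1 / Real.cosh (Real.pi * x)) ∧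
      ∫ x : ℝ, 1 / Real.cosh (Real.pi * x) = 1 := by
  have hint : Integrable (fun x : ℝ ↦ 1 / Real.cosh (Real.pi * x)) := by
    refine ((integrable_exp_neg_mul_abs Real.pi_pos).const_mul 2).mono'
      (Continuous.aestronglyMeasurable ?_) (Eventually.of_forall fun x ↦ ?_)
    · exact continuous_const.div (by fun_prop) fun x ↦ (Real.cosh_pos _).ne'
    · rw [Real.norm_of_nonneg (by have := Real.cosh_pos (Real.pi * x); positivity)]
      exact one_div_cosh_pi_mul_le x
  refine ⟨hint, ?_⟩
  -- The Gudermannian `arctan (sinh (π x))` is, up to the factor `π`, a primitive.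
  have hd (x : ℝ) : HasDerivAt (fun x ↦ Real.arctan (Real.sinh (Real.pi * x)) / Real.pi)
      (1 / Real.cosh (Real.pi * x)) x := by
    have h := ((((hasDerivAt_id x).const_mul Real.pi).sinh).arctan).div_const Real.pi
    refine h.congr_deriv ?_
    have hsq := Real.cosh_sq' (Real.pi * x)
    have hpos := Real.cosh_pos (Real.pi * x)
    have hpi := Real.pi_ne_zero
    simp only [id]
    rw [← hsq]
    field_simp
  have htop : Tendsto (fun x : ℝ ↦ Real.pi * x) atTop atTop :=
    tendsto_id.const_mul_atTop Real.pi_pos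
  have hbot : Tendsto (fun x : ℝ ↦ Real.pi * x) atBot atBot :=
    tendsto_id.const_mul_atBot Real.pi_pos
  have ht := ((tendsto_nhdsWithin_iff.1 Real.tendsto_arctan_atTop).1.comp
    (Real.sinhOrderIso.tendsto_atTop.comp htop)).div_const Real.pi
  have hb := ((tendsto_nhdsWithin_iff.1 Real.tendsto_arctan_atBot).1.comp
    (Real.sinhOrderIso.tendsto_atBot.comp hbot)).div_const Real.pi
  rw [integral_of_hasDerivAt_of_tendsto hd hint hb ht]
  have := Real.pi_ne_zero
  field_simp
  ring

/-- Growth of order `exp (π |y| / 2)` is absorbed by the weight `1 / cosh (π y)`. -/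
lemma integrable_div_cosh {h : ℝ → ℂ} (hc : Continuous h) {B : ℝ}
    (hB : ∀ y, ‖h y‖ ≤ B * Real.exp (Real.pi / 2 * |y|)) :
    Integrable (fun y : ℝ ↦ h y / (Real.cosh (Real.pi * y) : ℂ)) := by
  refine ((integrable_exp_neg_mul_abs (half_pos Real.pi_pos)).const_mul (B * 2)).mono'
    (Continuous.aestronglyMeasurable ?_) (Eventually.of_forall fun y ↦ ?_)
  · refine hc.div (by fun_prop) fun x ↦ ?_
    exact_mod_cast (Real.cosh_pos _).ne'
  · rw [div_eq_mul_one_div, norm_mul, norm_div, norm_one, Complex.norm_real,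
      Real.norm_of_nonneg (Real.cosh_pos _).le]
    calc _ ≤ (B * Real.exp (Real.pi / 2 * |y|)) * (2 * Real.exp (-(Real.pi * |y|))) := by
          gcongr
          · exact (norm_nonneg _).trans (hB y)
          · exact hB y
          · exact one_div_cosh_pi_mul_le y
      _ = B * 2 * (Real.exp (Real.pi / 2 * |y|) * Real.exp (-(Real.pi * |y|))) := by ring
      _ = _ := by rw [← Real.exp_add]; ring_nf

/-- The integral of `g` over the vertical line of real part `c` against the weight
`1 / cosh (π y)`. At a half-integer `c` this weight is `1 / sin (π s)` up to sign. -/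
noncomputable def sechIntegral (g : ℂ → ℂ) (c : ℝ) : ℂ :=
  ∫ y : ℝ, g (c + y * Complex.I) / (Real.cosh (Real.pi * y) : ℂ)

open Complex in
/-- Shift of a vertical line of integration: in Cauchy's theorem for the rectangles of height `2T`
the horizontal sides are at most `M T * (b - a)` in norm and disappear as `T → ∞`. -/
lemma vertical_integral_eq_of_decay {F : ℂ → ℂ} {a b : ℝ} (hab : a ≤ b)
    (hF : ∀ s : ℂ, a ≤ s.re → s.re ≤ b → DifferentiableAt ℂ F s) {M : ℝ → ℝ}
    (hM : Tendsto M atTop (𝓝 0))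
    (hFM : ∀ s : ℂ, a ≤ s.re → s.re ≤ b → 1 ≤ |s.im| → ‖F s‖ ≤ M |s.im|)
    (ha : Integrable fun y : ℝ ↦ F (a + y * I)) (hb : Integrable fun y : ℝ ↦ F (b + y * I)) :
    ∫ y : ℝ, F (b + y * I) = ∫ y : ℝ, F (a + y * I) := by
  have hrect (T : ℝ) :
      (∫ x : ℝ in a..b, F (x + (-T : ℝ) * I)) - (∫ x : ℝ in a..b, F (x + (T : ℝ) * I)) +
        I • (∫ y : ℝ in (-T)..T, F (b + y * I)) - I • ∫ y : ℝ in (-T)..T, F (a + y * I) = 0 := by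
    have := Complex.integral_boundary_rect_eq_zero_of_differentiableOn F ⟨a, -T⟩ ⟨b, T⟩
      (fun s hs ↦ ?_)
    · simpa using this
    · have h1 : s.re ∈ Set.uIcc a b := hs.1
      rw [Set.uIcc_of_le hab] at h1
      exact (hF s h1.1 h1.2).differentiableWithinAt
  have hhor (e : ℝ → ℝ) (he : ∀ T, |e T| = |T|) :
      Tendsto (fun T : ℝ ↦ ∫ x : ℝ in a..b, F (x + (e T : ℝ) * I)) atTop (𝓝 0) := by
    refine squeeze_zero_norm' (a := fun T ↦ M T * |b - a|) ?_ (by simpa using hM.mul_const _)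
    filter_upwards [eventually_ge_atTop 1] with T hT
    refine intervalIntegral.norm_integral_le_of_norm_le_const fun x hx ↦ ?_
    rw [Set.uIoc_of_le hab] at hx
    have him : |((x : ℂ) + (e T : ℝ) * I).im| = T := by
      simp [he, abs_of_nonneg (zero_le_one.trans hT)]
    have hre : ((x : ℂ) + (e T : ℝ) * I).re = x := by simp
    have := hFM ((x : ℂ) + (e T : ℝ) * I) (by rw [hre]; exact hx.1.le) (by rw [hre]; exact hx.2)
      (by rw [him]; exact hT)
    rwa [him] at this
  have hlim := (((hhor (fun T ↦ -T) fun T ↦ abs_neg T).sub (hhor (fun T ↦ T) fun T ↦ rfl)).add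
    ((intervalIntegral_tendsto_integral hb tendsto_neg_atTop_atBot tendsto_id).const_smul I)).sub
    ((intervalIntegral_tendsto_integral ha tendsto_neg_atTop_atBot tendsto_id).const_smul I)
  have h0 := tendsto_nhds_unique hlim (tendsto_const_nhds.congr fun T ↦ (hrect T).symm)
  rw [sub_zero, zero_add, ← smul_sub, smul_eq_zero, sub_eq_zero] at h0
  exact h0.resolve_left I_ne_zero

lemma Complex.sin_pi_mul_ne_zero {s : ℂ} (hs : |s.re| ≤ 1 / 2) (h0 : s ≠ 0) :
    Complex.sin (Real.pi * s) ≠ 0 := by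
  rw [Ne, Complex.sin_eq_zero_iff]
  rintro ⟨k, hk⟩
  have hpi : (Real.pi : ℂ) ≠ 0 := by exact_mod_cast Real.pi_ne_zero
  have hsk : s = k := by
    refine mul_left_cancel₀ hpi (hk.trans (mul_comm _ _))
  rw [hsk, Complex.intCast_re] at hs
  have hk1 : |k| < 1 := by
    have : ((|k| : ℤ) : ℝ) < 1 := by push_cast; linarith
    exact_mod_cast this
  rw [Int.abs_lt_one_iff] at hk1
  exact h0 (by rw [hsk, hk1, Int.cast_zero])

open Complex in
/-- The residue theorem for `g s / sin (π s)` on the strip `|Re s| ≤ 1 / 2`, obtained by shifting the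
line of integration for `(g s - g 0) / sin (π s)`. The two lines enter with the same sign because
`sin (π s)` equals `cosh (π y)` on the right one and `-cosh (π y)` on the left one. -/
lemma sechIntegral_half_add_sechIntegral_neg_half {g : ℂ → ℂ} {U : Set ℂ} (hU : IsOpen U)
    (hsub : ∀ s : ℂ, |s.re| ≤ 1 / 2 → s ∈ U) (hg : DifferentiableOn ℂ g U) {B : ℝ}
    (hB : ∀ s : ℂ, |s.re| ≤ 1 / 2 → ‖g s‖ ≤ B * Real.exp (Real.pi / 2 * |s.im|)) :
    sechIntegral g (1 / 2) + sechIntegral g (-(1 / 2)) = 2 * g 0 := by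
  have hU0 : U ∈ 𝓝 (0 : ℂ) := hU.mem_nhds (hsub 0 (by simp))
  have hB0 : ‖g 0‖ ≤ B := by simpa using hB 0 (by simp)
  have hBnn : 0 ≤ B := (norm_nonneg _).trans hB0
  have hg' (s : ℂ) (hs : |s.re| ≤ 1 / 2) : DifferentiableAt ℂ g s :=
    hg.differentiableAt (hU.mem_nhds (hsub s hs))
  have hre (c y : ℝ) : ((c : ℂ) + y * I).re = c := by simp
  have him (c y : ℝ) : ((c : ℂ) + y * I).im = y := by simp
  -- The quotient of the two slopes is `(g s - g 0) / sin (π s)` with the singularity removed.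
  set S : ℂ → ℂ := fun s ↦ Complex.sin (Real.pi * s) with hS
  have hSd : Differentiable ℂ S := by fun_prop
  set F : ℂ → ℂ := fun s ↦ dslope g 0 s / dslope S 0 s with hFdef
  have hFne (s : ℂ) (h0 : s ≠ 0) : F s = (g s - g 0) / Complex.sin (Real.pi * s) := by
    simp only [hFdef, dslope_of_ne _ h0, slope_def_field, hS, sub_zero, mul_zero, Complex.sin_zero]
    rw [div_div_div_cancel_right₀ h0]
  have hSne (s : ℂ) (hs : |s.re| ≤ 1 / 2) : dslope S 0 s ≠ 0 := by
    rcases eq_or_ne s 0 with rfl | h0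
    · have : HasDerivAt S (Real.pi : ℂ) 0 := by
        simpa using ((hasDerivAt_id (0 : ℂ)).const_mul (Real.pi : ℂ)).csin
      rw [dslope_same, this.deriv]
      exact_mod_cast Real.pi_ne_zero
    · rw [dslope_of_ne _ h0, slope_def_field]
      simpa [hS, h0] using Complex.sin_pi_mul_ne_zero hs h0
  have hFd (s : ℂ) (hs : |s.re| ≤ 1 / 2) : DifferentiableAt ℂ F s := by
    refine DifferentiableAt.div ?_ ?_ (hSne s hs)
    · exact ((differentiableOn_dslope hU0).2 hg).differentiableAt (hU.mem_nhds (hsub s hs))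
    · exact ((differentiableOn_dslope univ_mem).2 hSd.differentiableOn).differentiableAt univ_mem
  have hFM (s : ℂ) (hs : |s.re| ≤ 1 / 2) (ht : 1 ≤ |s.im|) :
      ‖F s‖ ≤ 8 * B * Real.exp (-(Real.pi / 2 * |s.im|)) := by
    have h0 : s ≠ 0 := by rintro rfl; norm_num at ht
    rw [hFne s h0, norm_div]
    have hpt : 3 ≤ Real.pi * |s.im| := by nlinarith [Real.pi_gt_three]
    have hnum : ‖g s - g 0‖ ≤ 2 * B * Real.exp (Real.pi / 2 * |s.im|) := by
      have h1 : 1 ≤ Real.exp (Real.pi / 2 * |s.im|) := Real.one_le_exp (by linarith)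
      have := norm_sub_le (g s) (g 0)
      nlinarith [hB s hs]
    have hden : Real.exp (Real.pi * |s.im|) / 4 ≤ ‖Complex.sin (Real.pi * s)‖ := by
      refine le_trans ?_ (Complex.sinh_abs_im_le_norm_sin _)
      have : ((Real.pi : ℂ) * s).im = Real.pi * s.im := by simp
      rw [this, abs_mul, abs_of_pos Real.pi_pos, Real.sinh_eq]
      have h1 : Real.exp (-(Real.pi * |s.im|)) ≤ 1 := Real.exp_le_one_iff.2 (by linarith)
      have h2 := Real.add_one_le_exp (Real.pi * |s.im|)
      linarith
    calc _ ≤ 2 * B * Real.exp (Real.pi / 2 * |s.im|) / (Real.exp (Real.pi * |s.im|) / 4) := by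
          gcongr
      _ = 8 * B * (Real.exp (Real.pi / 2 * |s.im|) * (Real.exp (Real.pi * |s.im|))⁻¹) := by
          ring
      _ = _ := by rw [← Real.exp_neg, ← Real.exp_add]; ring_nf
  -- On the two boundary lines `sin (π s)` is `± cosh (π y)`.
  have hline (c : ℝ) (hc : c = 1 / 2 ∨ c = -(1 / 2)) (y : ℝ) :
      F (c + y * I) = 2 * c * (g (c + y * I) / (Real.cosh (Real.pi * y) : ℂ) -
        g 0 * ((1 / Real.cosh (Real.pi * y) : ℝ) : ℂ)) := by
    have hne : (c : ℂ) + y * I ≠ 0 := by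
      intro h
      have := hre c y
      rw [h] at this
      rcases hc with rfl | rfl <;> norm_num at this
    have hsin : Complex.sin (Real.pi * (c + y * I)) = 2 * c * (Real.cosh (Real.pi * y) : ℂ) := by
      rw [mul_add, ← mul_assoc, Complex.sin_add_mul_I]
      rcases hc with rfl | rfl
      · have e : (Real.pi : ℂ) * ((1 / 2 : ℝ) : ℂ) = Real.pi / 2 := by push_cast; ring
        rw [e, Complex.sin_pi_div_two, Complex.cos_pi_div_two]
        push_cast; ring
      · have e : (Real.pi : ℂ) * ((-(1 / 2) : ℝ) : ℂ) = -(Real.pi / 2) := by push_cast; ring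
        rw [e, Complex.sin_neg, Complex.cos_neg, Complex.sin_pi_div_two, Complex.cos_pi_div_two]
        push_cast; ring
    have hch : (Real.cosh (Real.pi * y) : ℂ) ≠ 0 := by exact_mod_cast (Real.cosh_pos _).ne'
    rw [hFne _ hne, hsin]
    rcases hc with rfl | rfl
    all_goals
      push_cast at hch ⊢
      field_simp
      try ring
  have hgint (c : ℝ) (hc : |c| ≤ 1 / 2) :
      Integrable fun y : ℝ ↦ g (c + y * I) / (Real.cosh (Real.pi * y) : ℂ) := by
    refine integrable_div_cosh (B := B) ?_ fun y ↦ ?_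
    · rw [continuous_iff_continuousAt]
      intro y
      exact ContinuousAt.comp (f := fun y : ℝ ↦ (c : ℂ) + y * I)
        (hg' _ (by rw [hre]; exact hc)).continuousAt (by fun_prop)
    · simpa [him] using hB (c + y * I) (by rw [hre]; exact hc)
  obtain ⟨hsi, hs1⟩ := integral_one_div_cosh_pi_mul
  have hcint (c : ℝ) (hc : |c| ≤ 1 / 2) :
      Integrable (fun y : ℝ ↦ 2 * (c : ℂ) * (g (c + y * I) / (Real.cosh (Real.pi * y) : ℂ) -
        g 0 * ((1 / Real.cosh (Real.pi * y) : ℝ) : ℂ))) :=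
    ((hgint c hc).sub (hsi.ofReal.const_mul _)).const_mul _
  have hval (c : ℝ) (hc : |c| ≤ 1 / 2) :
      ∫ y : ℝ, 2 * (c : ℂ) * (g (c + y * I) / (Real.cosh (Real.pi * y) : ℂ) -
        g 0 * ((1 / Real.cosh (Real.pi * y) : ℝ) : ℂ)) = 2 * c * (sechIntegral g c - g 0) := by
    have hsiC : Integrable (fun y : ℝ ↦ g 0 * ((1 / Real.cosh (Real.pi * y) : ℝ) : ℂ)) :=
      hsi.ofReal.const_mul _
    have hs1C : ∫ y : ℝ, ((1 / Real.cosh (Real.pi * y) : ℝ) : ℂ) = 1 := by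
      rw [integral_complex_ofReal, hs1, Complex.ofReal_one]
    rw [integral_const_mul, integral_sub (hgint c hc) hsiC, integral_const_mul, hs1C, sechIntegral,
      mul_one]
  have hp : |(1 / 2 : ℝ)| ≤ 1 / 2 := by rw [abs_of_pos (by norm_num)]
  have hm : |(-(1 / 2) : ℝ)| ≤ 1 / 2 := by rw [abs_neg]; exact hp
  have htend : Tendsto (fun T : ℝ ↦ 8 * B * Real.exp (-(Real.pi / 2 * T))) atTop (𝓝 0) := by
    simpa using (Real.tendsto_exp_neg_atTop_nhds_zero.comp
      (tendsto_id.const_mul_atTop (half_pos Real.pi_pos))).const_mul (8 * B)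
  have hmain := vertical_integral_eq_of_decay (F := F) (a := -(1 / 2)) (b := 1 / 2) (by norm_num)
    (fun s h1 h2 ↦ hFd s (abs_le.2 ⟨h1, h2⟩)) htend
    (fun s h1 h2 ↦ hFM s (abs_le.2 ⟨h1, h2⟩))
    ((hcint _ hm).congr (Eventually.of_forall fun y ↦ (hline _ (Or.inr rfl) y).symm))
    ((hcint _ hp).congr (Eventually.of_forall fun y ↦ (hline _ (Or.inl rfl) y).symm))
  rw [integral_congr_ae (Eventually.of_forall (hline _ (Or.inl rfl))),
    integral_congr_ae (Eventually.of_forall (hline _ (Or.inr rfl))), hval _ hp, hval _ hm] at hmain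
  push_cast at hmain
  linear_combination hmain

/-- The strip identity centred at `m`. The centre need not be an integer: the weight in
`sechIntegral` depends only on the imaginary part. -/
lemma sechIntegral_add_half_add_sechIntegral_sub_half {g : ℂ → ℂ} {U : Set ℂ} (hU : IsOpen U)
    (m : ℝ) (hsub : ∀ s : ℂ, |s.re - m| ≤ 1 / 2 → s ∈ U) (hg : DifferentiableOn ℂ g U) {B : ℝ}
    (hB : ∀ s : ℂ, |s.re - m| ≤ 1 / 2 → ‖g s‖ ≤ B * Real.exp (Real.pi / 2 * |s.im|)) :
    sechIntegral g (m + 1 / 2) + sechIntegral g (m - 1 / 2) = 2 * g m := by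
  have hshift (c : ℝ) : sechIntegral (fun s ↦ g (s + m)) c = sechIntegral g (m + c) := by
    simp only [sechIntegral]
    congr! 4 with y
    push_cast; ring
  have h := sechIntegral_half_add_sechIntegral_neg_half (g := fun s ↦ g (s + m)) (B := B)
    (hU.preimage (continuous_add_const (m : ℂ)))
    (fun s hs ↦ hsub _ (by simpa using hs))
    (hg.comp (by fun_prop) fun s hs ↦ hs)
    (fun s hs ↦ by simpa using hB (s + m) (by simpa using hs))
  rw [hshift, hshift, zero_add, ← sub_eq_add_neg] at h
  exact h

/-! ### The function `ζ(s) / (s + ω)` and the series -/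

lemma re_add_le_norm_add (s ω : ℂ) : s.re + ω.re ≤ ‖s + ω‖ := by
  simpa using Complex.re_le_norm (s + ω)

lemma add_ne_zero_of_re_pos {ω : ℂ} {s : ℂ} (h : 0 < s.re + ω.re) : s + ω ≠ 0 :=
  norm_pos_iff.1 (h.trans_le (re_add_le_norm_add s ω))

lemma sechIntegral_zeta_div_add {ω : ℂ} (hω : -(1 / 2 : ℝ) < ω.re) {j : ℕ} (hj : 2 ≤ j) :
    sechIntegral (fun s ↦ riemannZeta s / (s + ω)) (j + 1 / 2) +
      sechIntegral (fun s ↦ riemannZeta s / (s + ω)) (j - 1 / 2) =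
        2 * (riemannZeta j / (j + ω)) := by
  obtain ⟨C, hC⟩ := exists_norm_riemannZeta_le_of_three_halves_le_re
  have hj' : (2 : ℝ) ≤ j := by exact_mod_cast hj
  have h := sechIntegral_add_half_add_sechIntegral_sub_half
    (g := fun s ↦ riemannZeta s / (s + ω)) (U := {s : ℂ | 1 < s.re}) (B := C)
    (isOpen_lt continuous_const Complex.continuous_re) j (fun s hs ↦ ?_) (fun s hs ↦ ?_)
    (fun s hs ↦ ?_)
  · simpa using h
  · have := (abs_le.1 hs).1
    simp only [Set.mem_ofPred_eq]
    linarith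
  · have hs' : 1 < s.re := hs
    refine DifferentiableAt.differentiableWithinAt (DifferentiableAt.div
      (differentiableAt_riemannZeta ?_) (by fun_prop) (add_ne_zero_of_re_pos (by linarith)))
    rintro rfl
    simp at hs'
  · have h1 := (abs_le.1 hs).1
    have h2 : ‖riemannZeta s‖ ≤ C := hC s (by linarith)
    have hC0 : 0 ≤ C := (norm_nonneg _).trans h2
    have h3 : 1 ≤ ‖s + ω‖ := le_trans (by linarith) (re_add_le_norm_add s ω)
    have hexp : 1 ≤ Real.exp (Real.pi / 2 * |s.im|) :=
      Real.one_le_exp (by have := Real.pi_pos; positivity)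
    rw [norm_div]
    calc _ ≤ C / 1 := by gcongr
      _ = C * 1 := by ring
      _ ≤ _ := by gcongr

lemma tendsto_sechIntegral_zeta_div_add {ω : ℂ} (hω : -(1 / 2 : ℝ) < ω.re) :
    Tendsto (fun N : ℕ ↦ sechIntegral (fun s ↦ riemannZeta s / (s + ω)) (N + 1 / 2)) atTop
      (𝓝 0) := by
  obtain ⟨C, hC⟩ := exists_norm_riemannZeta_le_of_three_halves_le_re
  obtain ⟨hsi, hs1⟩ := integral_one_div_cosh_pi_mul
  refine squeeze_zero_norm' (a := fun N : ℕ ↦ C / (N : ℝ)) ?_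
    (tendsto_const_div_atTop_nhds_zero_nat C)
  filter_upwards [eventually_ge_atTop 1] with N hN
  have hN' : (1 : ℝ) ≤ N := by exact_mod_cast hN
  have hle : ‖sechIntegral (fun s ↦ riemannZeta s / (s + ω)) (N + 1 / 2)‖ ≤
      ∫ y : ℝ, C / (N : ℝ) * (1 / Real.cosh (Real.pi * y)) := by
    refine norm_integral_le_of_norm_le (hsi.const_mul _) (Eventually.of_forall fun y ↦ ?_)
    set s : ℂ := ((N + 1 / 2 : ℝ) : ℂ) + y * Complex.I with hs
    have hre : s.re = N + 1 / 2 := by simp [hs]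
    have h1 : ‖riemannZeta s‖ ≤ C := hC s (by rw [hre]; linarith)
    have hC0 : 0 ≤ C := (norm_nonneg _).trans h1
    have h2 : (N : ℝ) ≤ ‖s + ω‖ := le_trans (by rw [hre]; linarith) (re_add_le_norm_add s ω)
    have := Real.cosh_pos (Real.pi * y)
    rw [norm_div, norm_div, Complex.norm_real, Real.norm_of_nonneg this.le, div_eq_mul_one_div]
    gcongr
  rwa [integral_const_mul, hs1, mul_one] at hle

/-- The partial sums telescope: each term of the series is half the sum of the integrals over the two
lines that surround its index. -/
lemma two_mul_nuPartialSum {ω : ℂ} (hω : -(1 / 2 : ℝ) < ω.re) {N : ℕ} (hN : 1 ≤ N) :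
    2 * nuPartialSum ω N =
      (-1) ^ N * sechIntegral (fun s ↦ riemannZeta s / (s + ω)) (N + 1 / 2) +
        sechIntegral (fun s ↦ riemannZeta s / (s + ω)) (3 / 2) := by
  induction N, hN using Nat.le_induction with
  | base =>
    -- For `N = 1` the sum is empty and the two integrals cancel.
    have e : ((1 : ℕ) : ℝ) + 1 / 2 = 3 / 2 := by norm_num
    rw [e]
    simp [nuPartialSum]
  | succ n hn ih =>
    have h := sechIntegral_zeta_div_add hω (j := n + 1) (by omega)
    have e : ((n + 1 : ℕ) : ℝ) - 1 / 2 = n + 1 / 2 := by push_cast; ring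
    rw [e] at h
    rw [nuPartialSum, Finset.sum_Icc_succ_top (by omega), ← nuPartialSum, mul_add, ih, pow_succ]
    linear_combination (-1 : ℂ) ^ n * h

/-- The contribution of the double pole of `ζ(s) / ((s + ω) sin (π s))` at `s = 1`, together with
the absolute convergence of the integral over the critical line. -/
lemma sechIntegral_zeta_div_add_three_halves_add_half {ω : ℂ} (hω : -(1 / 2 : ℝ) < ω.re) :
    (Integrable fun y : ℝ ↦ riemannZeta ((1 / 2 : ℝ) + y * Complex.I) /
      ((1 / 2 : ℝ) + y * Complex.I + ω) / (Real.cosh (Real.pi * y) : ℂ)) ∧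
    sechIntegral (fun s ↦ riemannZeta s / (s + ω)) (3 / 2) +
      sechIntegral (fun s ↦ riemannZeta s / (s + ω)) (1 / 2) =
        2 * ((Real.eulerMascheroniConstant : ℂ) / (ω + 1) - 1 / (ω + 1) ^ 2) := by
  have h1ω : (1 : ℂ) + ω ≠ 0 := add_ne_zero_of_re_pos (by simp; linarith)
  set p : ℂ → ℂ := fun s ↦ (s - 1)⁻¹ with hp
  set g : ℂ → ℂ := fun s ↦ (riemannZeta₀ s - (1 + ω)⁻¹) / (s + ω) with hgdef
  have hdecomp (s : ℂ) (h1 : s ≠ 1) (h2 : s + ω ≠ 0) :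
      riemannZeta s / (s + ω) = g s + (1 + ω)⁻¹ * p s := by
    have h1' : s - 1 ≠ 0 := sub_ne_zero.2 h1
    simp only [hgdef, hp, riemannZeta_eq_inv_sub_add h1]
    field_simp
    ring
  obtain ⟨B, hB⟩ := exists_norm_riemannZeta₀_le_exp
  have hd : 0 < 1 / 2 + ω.re := by linarith
  have hgB (s : ℂ) (hl : 1 / 2 ≤ s.re) (hr : s.re ≤ 3 / 2) :
      ‖g s‖ ≤ (B + ‖(1 + ω)⁻¹‖) / (1 / 2 + ω.re) * Real.exp (Real.pi / 2 * |s.im|) := by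
    have hexp : 1 ≤ Real.exp (Real.pi / 2 * |s.im|) :=
      Real.one_le_exp (by have := Real.pi_pos; positivity)
    have hnum : ‖riemannZeta₀ s - (1 + ω)⁻¹‖ ≤
        (B + ‖(1 + ω)⁻¹‖) * Real.exp (Real.pi / 2 * |s.im|) := by
      have := norm_sub_le (riemannZeta₀ s) (1 + ω)⁻¹
      nlinarith [hB s hl hr, norm_nonneg (1 + ω)⁻¹]
    have hden : 1 / 2 + ω.re ≤ ‖s + ω‖ := le_trans (by linarith) (re_add_le_norm_add s ω)
    rw [hgdef, norm_div, div_mul_eq_mul_div]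
    gcongr
    exact (norm_nonneg _).trans hnum
  have hgd (s : ℂ) (hs : 0 < s.re + ω.re) : DifferentiableAt ℂ g s :=
    DifferentiableAt.div (by fun_prop) (by fun_prop) (add_ne_zero_of_re_pos hs)
  have hre (c y : ℝ) : ((c : ℂ) + y * Complex.I).re = c := by simp
  have him (c y : ℝ) : ((c : ℂ) + y * Complex.I).im = y := by simp
  have hgint (c : ℝ) (hl : 1 / 2 ≤ c) (hr : c ≤ 3 / 2) :
      Integrable fun y : ℝ ↦ g (c + y * Complex.I) / (Real.cosh (Real.pi * y) : ℂ) := by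
    refine integrable_div_cosh (B := (B + ‖(1 + ω)⁻¹‖) / (1 / 2 + ω.re)) ?_ fun y ↦ ?_
    · rw [continuous_iff_continuousAt]
      intro y
      exact ContinuousAt.comp (f := fun y : ℝ ↦ (c : ℂ) + y * Complex.I)
        (hgd _ (by rw [hre]; linarith)).continuousAt (by fun_prop)
    · simpa [him] using hgB (c + y * Complex.I) (by rwa [hre]) (by rwa [hre])
  have hpnorm (c : ℝ) (hc : |c - 1| = 1 / 2) (y : ℝ) :
      1 / 2 ≤ ‖(c : ℂ) + y * Complex.I - 1‖ := by
    have := Complex.abs_re_le_norm ((c : ℂ) + y * Complex.I - 1)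
    rw [Complex.sub_re, hre, Complex.one_re, hc] at this
    exact this
  have hne (c : ℝ) (hc : |c - 1| = 1 / 2) (y : ℝ) : (c : ℂ) + y * Complex.I ≠ 1 := by
    intro h
    have := hpnorm c hc y
    rw [h] at this
    norm_num at this
  have hpint (c : ℝ) (hc : |c - 1| = 1 / 2) :
      Integrable fun y : ℝ ↦ p (c + y * Complex.I) / (Real.cosh (Real.pi * y) : ℂ) := by
    refine integrable_div_cosh (B := 2) ?_ fun y ↦ ?_
    · exact Continuous.inv₀ (by fun_prop) fun y ↦ sub_ne_zero.2 (hne c hc y)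
    · have hexp : 1 ≤ Real.exp (Real.pi / 2 * |y|) :=
        Real.one_le_exp (by have := Real.pi_pos; positivity)
      have : ‖p (c + y * Complex.I)‖ ≤ 2 := by
        rw [hp, norm_inv]
        exact inv_le_of_inv_le₀ (by norm_num) (by simpa using hpnorm c hc y)
      linarith
  have hline (c : ℝ) (hl : 1 / 2 ≤ c) (hc : |c - 1| = 1 / 2) (y : ℝ) :
      riemannZeta (c + y * Complex.I) / (c + y * Complex.I + ω) / (Real.cosh (Real.pi * y) : ℂ) =
        g (c + y * Complex.I) / (Real.cosh (Real.pi * y) : ℂ) +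
          (1 + ω)⁻¹ * (p (c + y * Complex.I) / (Real.cosh (Real.pi * y) : ℂ)) := by
    rw [hdecomp _ (hne c hc y) (add_ne_zero_of_re_pos (by rw [hre]; linarith)), add_div,
      mul_div_assoc]
  have hsplit (c : ℝ) (hl : 1 / 2 ≤ c) (hr : c ≤ 3 / 2) (hc : |c - 1| = 1 / 2) :
      sechIntegral (fun s ↦ riemannZeta s / (s + ω)) c =
        sechIntegral g c + (1 + ω)⁻¹ * sechIntegral p c := by
    rw [sechIntegral, integral_congr_ae (Eventually.of_forall (hline c hl hc)),
      integral_add (hgint c hl hr) ((hpint c hc).const_mul _), integral_const_mul]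
    rfl
  have hc1 : |(1 / 2 : ℝ) - 1| = 1 / 2 := by norm_num [abs_of_neg]
  have hc3 : |(3 / 2 : ℝ) - 1| = 1 / 2 := by norm_num [abs_of_pos]
  -- The polar part is odd under the point reflection `s ↦ 2 - s`.
  have hpzero : sechIntegral p (3 / 2) + sechIntegral p (1 / 2) = 0 := by
    rw [← eq_neg_iff_add_eq_zero, sechIntegral, sechIntegral, ← integral_neg,
      ← integral_neg_eq_self]
    congr 1 with y
    have e : (((3 / 2 : ℝ) : ℂ) + ((-y : ℝ) : ℂ) * Complex.I - 1) =
        -(((1 / 2 : ℝ) : ℂ) + y * Complex.I - 1) := by push_cast; ring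
    simp only [hp]
    rw [e, inv_neg, mul_neg, Real.cosh_neg, neg_div]
  have hstrip := sechIntegral_add_half_add_sechIntegral_sub_half
    (g := g) (U := {s : ℂ | -ω.re < s.re}) (B := (B + ‖(1 + ω)⁻¹‖) / (1 / 2 + ω.re))
    (isOpen_lt continuous_const Complex.continuous_re) 1
    (fun s hs ↦ by
      have := (abs_le.1 hs).1
      simp only [Set.mem_ofPred_eq]
      linarith)
    (fun s hs ↦ (hgd s (by
      have : -ω.re < s.re := hs
      linarith)).differentiableWithinAt)
    (fun s hs ↦ hgB s (by linarith [(abs_le.1 hs).1]) (by linarith [(abs_le.1 hs).2]))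
  have e3 : (1 : ℝ) + 1 / 2 = 3 / 2 := by norm_num
  have e1 : (1 : ℝ) - 1 / 2 = 1 / 2 := by norm_num
  have hg1 : g ((1 : ℝ) : ℂ) =
      (Real.eulerMascheroniConstant : ℂ) / (ω + 1) - 1 / (ω + 1) ^ 2 := by
    rw [hgdef, Complex.ofReal_one]
    simp only [riemannZeta₀_one]
    rw [add_comm ω 1]
    field_simp
  rw [e3, e1, hg1] at hstrip
  refine ⟨?_, ?_⟩
  · exact ((hgint _ le_rfl (by norm_num)).add ((hpint _ hc1).const_mul _)).congr
      (Eventually.of_forall fun y ↦ (hline _ le_rfl hc1 y).symm)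
  · rw [hsplit _ (by norm_num) le_rfl hc3, hsplit _ le_rfl (by norm_num) hc1]
    linear_combination hstrip + (1 + ω)⁻¹ * hpzero

lemma norm_nuKernel_le {ω : ℂ} (hω : -(1 / 2 : ℝ) < ω.re) (ε x : ℝ) :
    ‖nuKernel ω ε x‖ ≤ 2 / (1 / 2 + ω.re) * Real.exp (-(Real.pi * |x|)) := by
  have hd : 0 < 1 / 2 + ω.re := by linarith
  have h1 : 1 / 2 + ω.re ≤ ‖1 / 2 + (ε : ℂ) * Complex.I * (x : ℂ) + ω‖ := by
    have := re_add_le_norm_add (1 / 2 + (ε : ℂ) * Complex.I * (x : ℂ)) ω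
    simpa using this
  have hc := Real.cosh_pos (Real.pi * x)
  rw [nuKernel, norm_div, norm_mul, norm_one, Complex.norm_real, Real.norm_of_nonneg hc.le]
  calc _ ≤ 1 / ((1 / 2 + ω.re) * Real.cosh (Real.pi * x)) := by gcongr
    _ = 1 / (1 / 2 + ω.re) * (1 / Real.cosh (Real.pi * x)) := by
        rw [one_div_mul_one_div]
    _ ≤ 1 / (1 / 2 + ω.re) * (2 * Real.exp (-(Real.pi * |x|))) := by
        gcongr
        exact one_div_cosh_pi_mul_le x
    _ = _ := by ring

theorem theorem1 (ω : ℂ) (hω : -(1 / 2 : ℝ) < ω.re) (ε : ℝ) (hε : ε = 1 ∨ ε = -1) :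
    (∃ C : ℝ, ∀ x : ℝ, ‖nuKernel ω ε x‖ ≤ C * Real.exp (-(Real.pi * |x|))) ∧
    Integrable (fun x : ℝ =>
      riemannZeta (1 / 2 + (ε : ℂ) * Complex.I * (x : ℂ)) * nuKernel ω ε x) ∧
    Tendsto (nuPartialSum ω) atTop
      (𝓝 (-(1 / (ω + 1) ^ 2) + (Real.eulerMascheroniConstant : ℂ) / (ω + 1)
        - 1 / 2 * ∫ x : ℝ,
            riemannZeta (1 / 2 + (ε : ℂ) * Complex.I * (x : ℂ)) * nuKernel ω ε x)) := by
  obtain ⟨hint, hone⟩ := sechIntegral_zeta_div_add_three_halves_add_half hω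
  set h : ℝ → ℂ := fun y ↦ riemannZeta ((1 / 2 : ℝ) + y * Complex.I) /
    ((1 / 2 : ℝ) + y * Complex.I + ω) / (Real.cosh (Real.pi * y) : ℂ) with hh
  have hform : (fun x : ℝ ↦ riemannZeta (1 / 2 + (ε : ℂ) * Complex.I * (x : ℂ)) *
      nuKernel ω ε x) = fun x ↦ h (ε * x) := by
    funext x
    have hcosh : Real.cosh (Real.pi * (ε * x)) = Real.cosh (Real.pi * x) := by
      rcases hε with rfl | rfl
      · rw [one_mul]
      · rw [neg_one_mul, mul_neg, Real.cosh_neg]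
    have hs : (((1 / 2 : ℝ) : ℂ) + ((ε * x : ℝ) : ℂ) * Complex.I) =
        1 / 2 + (ε : ℂ) * Complex.I * x := by push_cast; ring
    simp only [hh, hcosh, hs, nuKernel]
    rw [mul_one_div, div_div]
  -- Changing the sign `ε` amounts to the reflection `x ↦ -x`, which preserves the integral.
  have hval : (Integrable fun x ↦ h (ε * x)) ∧
      ∫ x, h (ε * x) = sechIntegral (fun s ↦ riemannZeta s / (s + ω)) (1 / 2) := by
    rcases hε with rfl | rfl
    · simp only [one_mul]
      exact ⟨hint, rfl⟩
    · simp only [neg_one_mul]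
      exact ⟨hint.comp_neg, integral_neg_eq_self h volume⟩
  rw [hform]
  refine ⟨⟨_, norm_nuKernel_le hω ε⟩, hval.1, ?_⟩
  rw [hval.2]
  have hsign : Tendsto (fun N : ℕ ↦ (-1 : ℂ) ^ N *
      sechIntegral (fun s ↦ riemannZeta s / (s + ω)) (N + 1 / 2)) atTop (𝓝 0) := by
    rw [tendsto_zero_iff_norm_tendsto_zero]
    simpa using (tendsto_sechIntegral_zeta_div_add hω).norm
  have hlim := (hsign.add_const
    (sechIntegral (fun s ↦ riemannZeta s / (s + ω)) (3 / 2))).const_mul (1 / 2 : ℂ)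
  have hL : (1 / 2 : ℂ) * (0 + sechIntegral (fun s ↦ riemannZeta s / (s + ω)) (3 / 2)) =
      -(1 / (ω + 1) ^ 2) + (Real.eulerMascheroniConstant : ℂ) / (ω + 1)
        - 1 / 2 * sechIntegral (fun s ↦ riemannZeta s / (s + ω)) (1 / 2) := by
    linear_combination (1 / 2 : ℂ) * hone
  rw [hL] at hlim
  refine hlim.congr' ?_
  filter_upwards [eventually_ge_atTop 1] with N hN
  linear_combination -(1 / 2 : ℂ) * two_mul_nuPartialSum hω hN
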